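/- **Setting.** Let $\Omega\subset\mathbb R^d$, $d\in\{1,2,3\}$, be a nonempty bounded convex open set, $0<T<\infty$, $J=(0,T]$, $0<\alpha<1$, $\lambda\in\mathbb R$, $g\in L^\infty(\Omega\times\Omega)$. For every $t\in J$ let $A(\cdot,t)$ (symmetric-matrix-valued), $b(\cdot,t)$ ($\mathbb R^d$-valued) and $c(\cdot,t)$ be measurable on $\Omega$, where $A$ is bounded and elliptic uniformly in $t\in J$ (there are $0<m\le M$ with $m|\xi|^2\le \xi^TA(x,t)\xi\le M|\xi|^2$ for all $\xi\in\mathbb R^d$, all $t\in J$ and a.e. $x\in\Omega$), and $b,c$ are bounded uniformly in $t\in J$. Write $\|\cdot\|$ and $(\cdot,\cdot)$ for the norm and inner product of $L^2(\Omega)$ and $\|\cdot\|_1=(\|\cdot\|^2+\|\nabla\cdot\|^2)^{1/2}$. For $\phi,\psi\in H_0^1(\Omega)$ put $$a_0(t;\phi,\psi)=(A(\cdot,t)\nabla\phi,\nabla\psi),\quad a_1(t;\phi,\psi)=(b(\cdot,t)\cdot\nabla\phi+c(\cdot,t)\phi,\psi),\quad a=a_0+a_1,$$ and $(\mathcal I\phi)(x)=\int_\Omega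 \phi(y)g(x,y)\,dy$. Let $\beta_0>0$, $\beta_1,\beta_2\ge0$ be any constants with $$a_0(t;\phi,\phi)\ge\beta_0\|\phi\|_1^2,\qquad |a_1(t;\phi,\psi)|\le\beta_1\|\phi\|_1\|\psi\|,\qquad \|\mathcal I\chi\|\le\beta_2\|\chi\|$$ for all $t\in J$, $\phi,\psi\in H_0^1(\Omega)$, $\chi\in L^2(\Omega)$. **Scheme.** Let $N\ge1$, $\gamma\ge1$, $t_n=(n/N)^\gamma T$ for $0\le n\le N$, $\Delta t_n=t_n-t_{n-1}$, $\Delta t=\max_{1\le n\le N}\Delta t_n$, $\rho_n=\Delta t_n/\Delta t_{n-1}$ for $2\le n\le N$, and $\rho=\max_{2\le n\le N}\rho_n$ ($\rho:=0$ if $N=1$). With $k_\beta(t)=t^{\beta-1}/\Gamma(\beta)$ let $$K^{n,j}_{1-\alpha}=\frac1{\Delta t_j}\int_{t_{j-1}}^{t_j}k_{1-\alpha}(t_n-s)\,ds,\qquad D^\alpha_{t_n}\phi^n=\sum_{j=1}^nK^{n,j}_{1-\alpha}(\phi^j-\phi^{j-1}),$$ $$P^{n,n}_\alpha=\frac1{K^{n,n}_{1-\alpha}},\qquad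 P^{n,i}_\alpha=\frac1{K^{i,i}_{1-\alpha}}\sum_{j=i+1}^nP^{n,j}_\alpha\big(K^{j,i+1}_{1-\alpha}-K^{j,i}_{1-\alpha}\big)\quad(1\le i<n).$$ Let $E$ be one of the following: $E\phi^n=\phi^n$ (fully implicit method); $E\phi^n=\phi^{n-1}$ (IMEX method of order one); $E\phi^1=\phi^0$ and $E\phi^n=(1+\rho_n)\phi^{n-1}-\rho_n\phi^{n-2}$ for $n\ge2$ (IMEX method of order two). Let $S_h\subset H_0^1(\Omega)$ be a finite-dimensional subspace, let $f^n=f(t_n)\in L^2(\Omega)$, and let $u_h^0,\dots,u_h^N\in S_h$ satisfy $$(D^\alpha_{t_n}u_h^n,v_h)+a(t_n;u_h^n,v_h)=\lambda(\mathcal I(Eu_h^n),v_h)+(f^n,v_h)\qquad\forall v_h\in S_h,\ 1\le n\le N.$$ **Theorem ($L^2$-norm stability of the IMEX-L1-FEM).** Let $C_0=2$ and $$\Lambda_0=\begin{cases}\dfrac{\beta_1^2}{\beta_0}+2|\lambda|\beta_2&\text{for the fully implicit method and the IMEX method of order one},\\[2mm]\dfrac{\beta_1^2}{\beta_0}+2|\lambda|(1+2\rho)\beta_2&\text{for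 the IMEX method of order two,}\end{cases}$$ and assume that $$\Delta t<\left(\frac1{2\Lambda_0\Gamma(2-\alpha)}\right)^{1/\alpha}$$ (no condition if $\Lambda_0=0$). Then, for $1\le n\le N$, $$\|u_h^n\|\le 2C_0\,E_\alpha(2\Lambda_0t_n^\alpha)\Big(\|u_h^0\|+\max_{1\le j\le n}\sum_{i=1}^jP^{j,i}_\alpha\|f^i\|\Big),$$ where $E_\alpha(z)=\sum_{k=0}^\infty z^k/\Gamma(\alpha k+1)$ is the Mittag-Leffler function. -/

import Mathlib

open MeasureTheory
open scoped Distributions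

noncomputable section

namespace IMEXL1

/-! ### Lebesgue and Sobolev spaces on an open set -/

/-- The Euclidean space `ℝ^d`. -/
abbrev Pt (d : ℕ) : Type := EuclideanSpace ℝ (Fin d)

/-- The space `L²(Ω)`. -/
abbrev L2 {d : ℕ} (Ω : TopologicalSpace.Opens (Pt d)) : Type :=
  Lp ℝ 2 ((volume : Measure (Pt d)).restrict (Ω : Set (Pt d)))

/-- The space `L²(Ω; ℝ^d)`. -/
abbrev L2Vec {d : ℕ} (Ω : TopologicalSpace.Opens (Pt d)) : Type :=
  Lp (Pt d) 2 ((volume : Measure (Pt d)).restrict (Ω : Set (Pt d)))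

/-- `G` is the weak gradient of `u` in `Ω`: `∫ u ∂ᵢφ = - ∫ Gᵢ φ` for all test functions `φ`
and all `i`. -/
def IsWeakGradient {d : ℕ} {Ω : TopologicalSpace.Opens (Pt d)} (u : L2 Ω) (G : L2Vec Ω) : Prop :=
  ∀ (φ : 𝓓(Ω, ℝ)) (i : Fin d),
    ∫ x in (Ω : Set (Pt d)), u x * fderiv ℝ φ x (EuclideanSpace.single i 1) =
      - ∫ x in (Ω : Set (Pt d)), G x i * φ x

theorem memLp_testFunction {d : ℕ} {Ω : TopologicalSpace.Opens (Pt d)} (φ : 𝓓(Ω, ℝ)) :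
    MemLp φ 2 ((volume : Measure (Pt d)).restrict (Ω : Set (Pt d))) :=
  ((φ.contDiff.continuous).memLp_of_hasCompactSupport φ.hasCompactSupport).restrict _

theorem memLp_fderiv_testFunction {d : ℕ} {Ω : TopologicalSpace.Opens (Pt d)} (φ : 𝓓(Ω, ℝ))
    (v : Pt d) :
    MemLp (fun x => fderiv ℝ φ x v) 2
      ((volume : Measure (Pt d)).restrict (Ω : Set (Pt d))) := by
  refine MemLp.restrict _ (Continuous.memLp_of_hasCompactSupport ?_ ?_)
  · exact (φ.contDiff.continuous_fderiv (by simp)).clm_apply continuous_const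
  · exact φ.hasCompactSupport.fderiv_apply ℝ v

theorem memLp_coord {d : ℕ} {Ω : TopologicalSpace.Opens (Pt d)} (G : L2Vec Ω) (i : Fin d) :
    MemLp (fun x => G x i) 2 ((volume : Measure (Pt d)).restrict (Ω : Set (Pt d))) :=
  (EuclideanSpace.proj (𝕜 := ℝ) i).comp_memLp' (Lp.memLp G)

theorem IsWeakGradient.add {d : ℕ} {Ω : TopologicalSpace.Opens (Pt d)} {u v : L2 Ω}
    {G H : L2Vec Ω} (hu : IsWeakGradient u G) (hv : IsWeakGradient v H) :
    IsWeakGradient (u + v) (G + H) := by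
  intro φ i
  have e1 : ∫ x in (Ω : Set (Pt d)), (u + v : L2 Ω) x *
        fderiv ℝ φ x (EuclideanSpace.single i 1) =
      ∫ x in (Ω : Set (Pt d)), (u x * fderiv ℝ φ x (EuclideanSpace.single i 1) +
        v x * fderiv ℝ φ x (EuclideanSpace.single i 1)) := by
    refine integral_congr_ae ?_
    filter_upwards [Lp.coeFn_add u v] with x hx
    rw [hx, Pi.add_apply, add_mul]
  have e2 : ∫ x in (Ω : Set (Pt d)), (G + H : L2Vec Ω) x i * φ x =
      ∫ x in (Ω : Set (Pt d)), (G x i * φ x + H x i * φ x) := by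
    refine integral_congr_ae ?_
    filter_upwards [Lp.coeFn_add G H] with x hx
    rw [hx, Pi.add_apply, PiLp.add_apply, add_mul]
  have i1 := (Lp.memLp u).integrable_mul
    (memLp_fderiv_testFunction φ (EuclideanSpace.single i 1))
  have i2 := (Lp.memLp v).integrable_mul
    (memLp_fderiv_testFunction φ (EuclideanSpace.single i 1))
  have i3 := (memLp_coord G i).integrable_mul (memLp_testFunction φ)
  have i4 := (memLp_coord H i).integrable_mul (memLp_testFunction φ)
  rw [e1, e2]
  refine (integral_add i1 i2).trans (Eq.trans ?_ (congrArg Neg.neg (integral_add i3 i4).symm))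
  refine (congrArg₂ (· + ·) (hu φ i) (hv φ i)).trans ?_
  exact (neg_add _ _).symm

theorem IsWeakGradient.smul {d : ℕ} {Ω : TopologicalSpace.Opens (Pt d)} {u : L2 Ω}
    {G : L2Vec Ω} (r : ℝ) (hu : IsWeakGradient u G) :
    IsWeakGradient (r • u) (r • G) := by
  intro φ i
  have e1 : ∫ x in (Ω : Set (Pt d)), (r • u : L2 Ω) x *
        fderiv ℝ φ x (EuclideanSpace.single i 1) =
      ∫ x in (Ω : Set (Pt d)), r * (u x * fderiv ℝ φ x (EuclideanSpace.single i 1)) := by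
    refine integral_congr_ae ?_
    filter_upwards [Lp.coeFn_smul r u] with x hx
    rw [hx, Pi.smul_apply, smul_eq_mul, mul_assoc]
  have e2 : ∫ x in (Ω : Set (Pt d)), (r • G : L2Vec Ω) x i * φ x =
      ∫ x in (Ω : Set (Pt d)), r * (G x i * φ x) := by
    refine integral_congr_ae ?_
    filter_upwards [Lp.coeFn_smul r G] with x hx
    rw [hx, Pi.smul_apply, PiLp.smul_apply, smul_eq_mul, mul_assoc]
  rw [e1, e2, integral_const_mul, integral_const_mul, hu φ i, mul_neg]

theorem IsWeakGradient.zero {d : ℕ} {Ω : TopologicalSpace.Opens (Pt d)} :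
    IsWeakGradient (0 : L2 Ω) (0 : L2Vec Ω) := by
  intro φ i
  have e1 : ∫ x in (Ω : Set (Pt d)), (0 : L2 Ω) x *
      fderiv ℝ φ x (EuclideanSpace.single i 1) = 0 := by
    refine integral_eq_zero_of_ae ?_
    filter_upwards [Lp.coeFn_zero ℝ 2 ((volume : Measure (Pt d)).restrict (Ω : Set (Pt d)))]
      with x hx
    rw [hx]
    simp
  have e2 : ∫ x in (Ω : Set (Pt d)), (0 : L2Vec Ω) x i * φ x = 0 := by
    refine integral_eq_zero_of_ae ?_
    filter_upwards [Lp.coeFn_zero (Pt d) 2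
      ((volume : Measure (Pt d)).restrict (Ω : Set (Pt d)))] with x hx
    rw [hx]
    simp
  rw [e1, e2, neg_zero]

/-- The Sobolev space `H¹(Ω)`, as the space of pairs `(u, ∇u)` of an `L²` function and its (unique)
weak gradient. It inherits the norm `‖u‖₁ = (‖u‖² + ‖∇u‖²)^{1/2}`. -/
def H1 {d : ℕ} (Ω : TopologicalSpace.Opens (Pt d)) :
    Submodule ℝ (WithLp 2 (L2 Ω × L2Vec Ω)) where
  carrier := {p | IsWeakGradient p.fst p.snd}
  add_mem' hp hq := hp.add hq
  zero_mem' := IsWeakGradient.zero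
  smul_mem' r _ hp := hp.smul r

/-- The underlying `L²` function of an element of `H¹(Ω)`. -/
def fn {d : ℕ} {Ω : TopologicalSpace.Opens (Pt d)} (u : H1 Ω) : L2 Ω :=
  (u : WithLp 2 (L2 Ω × L2Vec Ω)).fst

/-- The weak gradient of an element of `H¹(Ω)`. -/
def grad {d : ℕ} {Ω : TopologicalSpace.Opens (Pt d)} (u : H1 Ω) : L2Vec Ω :=
  (u : WithLp 2 (L2 Ω × L2Vec Ω)).snd

/-- `C_c^∞(Ω)` as a subset of `H¹(Ω)`. -/
def testFunctions {d : ℕ} (Ω : TopologicalSpace.Opens (Pt d)) : Set (H1 Ω) :=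
  {u | ∃ φ : 𝓓(Ω, ℝ), fn u =ᵐ[(volume : Measure (Pt d)).restrict (Ω : Set (Pt d))] φ}

/-- `H¹₀(Ω)`: the closure of (the linear span of) `C_c^∞(Ω)` in `H¹(Ω)`. -/
def H10 {d : ℕ} (Ω : TopologicalSpace.Opens (Pt d)) : Submodule ℝ (H1 Ω) :=
  (Submodule.span ℝ (testFunctions Ω)).topologicalClosure

/-! ### The continuous problem -/

/-- The data `Ω`, `T`, `α`, `λ`, `A`, `b`, `c`, `g` of the problem
`∂ₜ^α u - ∇·(A ∇u) + b·∇u + c u - λ ∫_Ω u(y,t) g(·,y) dy = f` in `Ω × (0,T]`, with homogeneous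
Dirichlet boundary conditions. The coefficients are written with the time variable first. -/
structure Problem (d : ℕ) where
  /-- the domain -/
  Ω : TopologicalSpace.Opens (Pt d)
  /-- the final time -/
  T : ℝ
  /-- the order of the time derivative -/
  α : ℝ
  /-- the coefficient of the integral operator -/
  lam : ℝ
  /-- the diffusion matrix -/
  A : ℝ → Pt d → Matrix (Fin d) (Fin d) ℝ
  /-- the convection field -/
  b : ℝ → Pt d → Pt d
  /-- the reaction coefficient -/
  c : ℝ → Pt d → ℝ
  /-- the kernel of the integral operator -/
  g : Pt d → Pt d → ℝ
  dim_pos : 1 ≤ d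
  dim_le : d ≤ 3
  nonempty : (Ω : Set (Pt d)).Nonempty
  bounded : Bornology.IsBounded (Ω : Set (Pt d))
  convex : Convex ℝ (Ω : Set (Pt d))
  T_pos : 0 < T
  α_pos : 0 < α
  α_lt_one : α < 1
  A_meas : ∀ t ∈ Set.Ioc 0 T, ∀ i j,
    AEStronglyMeasurable (fun x => A t x i j) (volume.restrict (Ω : Set (Pt d)))
  A_symm : ∀ t ∈ Set.Ioc 0 T, ∀ᵐ x ∂volume.restrict (Ω : Set (Pt d)), (A t x).IsSymm
  A_elliptic : ∃ m M : ℝ, 0 < m ∧ 0 < M ∧ ∀ t ∈ Set.Ioc 0 T,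
    ∀ᵐ x ∂volume.restrict (Ω : Set (Pt d)), ∀ ξ : Pt d,
      m * ‖ξ‖ ^ 2 ≤ ∑ i, ∑ j, ξ i * A t x i j * ξ j ∧
      ∑ i, ∑ j, ξ i * A t x i j * ξ j ≤ M * ‖ξ‖ ^ 2
  b_meas : ∀ t ∈ Set.Ioc 0 T,
    AEStronglyMeasurable (b t) (volume.restrict (Ω : Set (Pt d)))
  b_bdd : ∃ C : ℝ, ∀ t ∈ Set.Ioc 0 T, ∀ᵐ x ∂volume.restrict (Ω : Set (Pt d)), ‖b t x‖ ≤ C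
  c_meas : ∀ t ∈ Set.Ioc 0 T,
    AEStronglyMeasurable (c t) (volume.restrict (Ω : Set (Pt d)))
  c_bdd : ∃ C : ℝ, ∀ t ∈ Set.Ioc 0 T, ∀ᵐ x ∂volume.restrict (Ω : Set (Pt d)), |c t x| ≤ C
  g_meas : AEStronglyMeasurable (Function.uncurry g)
    ((volume.restrict (Ω : Set (Pt d))).prod (volume.restrict (Ω : Set (Pt d))))
  g_bdd : ∃ C : ℝ, ∀ᵐ p ∂(volume.restrict (Ω : Set (Pt d))).prod
    (volume.restrict (Ω : Set (Pt d))), |g p.1 p.2| ≤ C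

namespace Problem

/-- The bilinear form `a₀(t; u, v) = (A(·,t) ∇u, ∇v)`. -/
def a0 {d : ℕ} (P : Problem d) (t : ℝ) (u v : H1 P.Ω) : ℝ :=
  ∫ x in (P.Ω : Set (Pt d)), ∑ i, ∑ j, P.A t x i j * grad u x j * grad v x i

/-- The bilinear form `a₁(t; u, v) = (b(·,t)·∇u + c(·,t) u, v)`. -/
def a1 {d : ℕ} (P : Problem d) (t : ℝ) (u v : H1 P.Ω) : ℝ :=
  ∫ x in (P.Ω : Set (Pt d)), (inner ℝ (P.b t x) (grad u x) + P.c t x * fn u x) * fn v x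

/-- The bilinear form `a = a₀ + a₁`. -/
def a {d : ℕ} (P : Problem d) (t : ℝ) (u v : H1 P.Ω) : ℝ :=
  P.a0 t u v + P.a1 t u v

/-- The integral operator `(I φ)(x) = ∫_Ω φ(y) g(x,y) dy`. -/
def intOp {d : ℕ} (P : Problem d) (φ : L2 P.Ω) (x : Pt d) : ℝ :=
  ∫ y in (P.Ω : Set (Pt d)), φ y * P.g x y

/-- `β₀ > 0` is a coercivity constant: `a₀(t; φ, φ) ≥ β₀ ‖φ‖₁²` on `H¹₀(Ω)`. -/
def IsCoercivityConst {d : ℕ} (P : Problem d) (β₀ : ℝ) : Prop :=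
  0 < β₀ ∧ ∀ t ∈ Set.Ioc 0 P.T, ∀ φ ∈ H10 P.Ω, β₀ * ‖φ‖ ^ 2 ≤ P.a0 t φ φ

/-- `β₁` is a bound for the lower order form: `|a₁(t; φ, ψ)| ≤ β₁ ‖φ‖₁ ‖ψ‖` on `H¹₀(Ω)`. -/
def IsLowerOrderBound {d : ℕ} (P : Problem d) (β₁ : ℝ) : Prop :=
  0 ≤ β₁ ∧ ∀ t ∈ Set.Ioc 0 P.T, ∀ φ ∈ H10 P.Ω, ∀ ψ ∈ H10 P.Ω,
    |P.a1 t φ ψ| ≤ β₁ * ‖φ‖ * ‖fn ψ‖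

/-- `β₂` is a bound for the integral operator on `L²(Ω)`: `‖I φ‖ ≤ β₂ ‖φ‖`. -/
def IsIntOpBound {d : ℕ} (P : Problem d) (β₂ : ℝ) : Prop :=
  0 ≤ β₂ ∧ ∀ φ : L2 P.Ω,
    eLpNorm (P.intOp φ) 2 (volume.restrict (P.Ω : Set (Pt d))) ≤ ENNReal.ofReal (β₂ * ‖φ‖)

end Problem

/-! ### The graded mesh and the discrete kernels -/

/-- The kernel `k_β(t) = t^{β-1} / Γ(β)`. -/
def kern (β t : ℝ) : ℝ := t ^ (β - 1) / Real.Gamma β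

/-- The Mittag-Leffler function `E_α(z) = ∑ₖ z^k / Γ(α k + 1)`. -/
def mittagLeffler (α z : ℝ) : ℝ := ∑' k : ℕ, z ^ k / Real.Gamma (α * k + 1)

/-- The graded mesh `t_n = (n/N)^γ T`. -/
def gradedMesh (T γ : ℝ) (N n : ℕ) : ℝ := ((n : ℝ) / N) ^ γ * T

/-- The step `Δt_n = t_n - t_{n-1}`, `n ≥ 1`. -/
def step (t : ℕ → ℝ) (n : ℕ) : ℝ := t n - t (n - 1)

/-- The maximal step `Δt = max_{1 ≤ n ≤ N} Δt_n`. -/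
def maxStep (t : ℕ → ℝ) (N : ℕ) (hN : 1 ≤ N) : ℝ :=
  (Finset.Icc 1 N).sup' (Finset.nonempty_Icc.mpr hN) (step t)

/-- The step ratio `ρ_n = Δt_n / Δt_{n-1}`, `n ≥ 2`. -/
def stepRatio (t : ℕ → ℝ) (n : ℕ) : ℝ := step t n / step t (n - 1)

/-- The maximal step ratio `ρ = max_{2 ≤ n ≤ N} ρ_n`; it is `0` if `N ≤ 1`, where there are no
step ratios. -/
def maxStepRatio (t : ℕ → ℝ) (N : ℕ) : ℝ :=
  if h : (Finset.Icc 2 N).Nonempty then (Finset.Icc 2 N).sup' h (stepRatio t) else 0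

/-- The discrete kernel `K_β^{n,j} = (1/Δt_j) ∫_{t_{j-1}}^{t_j} k_β(t_n - s) ds`, `1 ≤ j ≤ n`. -/
def discKernel (t : ℕ → ℝ) (β : ℝ) (n j : ℕ) : ℝ :=
  1 / step t j * ∫ s in (t (j - 1))..(t j), kern β (t n - s)

/-- The complementary discrete kernel `P_α^{n,i}`, `1 ≤ i ≤ n`. -/
def complKernel (t : ℕ → ℝ) (α : ℝ) (n i : ℕ) : ℝ :=
  1 / discKernel t (1 - α) i i *
    if i < n then
      ∑ j : Finset.Icc (i + 1) n, complKernel t α n j *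
        (discKernel t (1 - α) j (i + 1) - discKernel t (1 - α) j i)
    else 1
termination_by n - i
decreasing_by
  have := Finset.mem_Icc.mp j.2
  omega

/-! ### The scheme -/

/-- The L1 formula `D_{t_n}^α φ^n = ∑_{j=1}^n K_{1-α}^{n,j} (φ^j - φ^{j-1})`. -/
def l1Deriv {V : Type*} [AddCommGroup V] [Module ℝ V] (t : ℕ → ℝ) (α : ℝ) (φ : ℕ → V) (n : ℕ) :
    V :=
  ∑ j ∈ Finset.Icc 1 n, discKernel t (1 - α) n j • (φ j - φ (j - 1))

/-- The three variants of the method. -/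
inductive Method where
  | fullyImplicit
  | imexOrderOne
  | imexOrderTwo

/-- The operator `E` of each variant, for `n ≥ 1`. -/
def Method.extrap {V : Type*} [AddCommGroup V] [Module ℝ V] (m : Method) (t : ℕ → ℝ)
    (φ : ℕ → V) (n : ℕ) : V :=
  match m with
  | .fullyImplicit => φ n
  | .imexOrderOne => φ (n - 1)
  | .imexOrderTwo =>
      if n = 1 then φ 0
      else (1 + stepRatio t n) • φ (n - 1) - stepRatio t n • φ (n - 2)

/-- The constant `Λ₀` of each variant. -/
def Method.Lambda0 (m : Method) (lam β₀ β₁ β₂ ρ : ℝ) : ℝ :=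
  match m with
  | .fullyImplicit => β₁ ^ 2 / β₀ + 2 * |lam| * β₂
  | .imexOrderOne => β₁ ^ 2 / β₀ + 2 * |lam| * β₂
  | .imexOrderTwo => β₁ ^ 2 / β₀ + 2 * |lam| * (1 + 2 * ρ) * β₂

/-- `u⁰, …, u^N` is a solution of the fully discrete scheme in the finite element space `S` on the
mesh `t` with right-hand side `f`: `uⁿ ∈ S` for `0 ≤ n ≤ N` and
`(D_{t_n}^α uⁿ, v) + a(t_n; uⁿ, v) = λ (I(E uⁿ), v) + (f(t_n), v)` for all `v ∈ S`,
`1 ≤ n ≤ N`. -/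
def IsDiscreteSolution {d : ℕ} (P : Problem d) (S : Submodule ℝ (H1 P.Ω)) (m : Method)
    (t : ℕ → ℝ) (N : ℕ) (f : ℝ → L2 P.Ω) (u : ℕ → H1 P.Ω) : Prop :=
  (∀ n ≤ N, u n ∈ S) ∧
  ∀ n, 1 ≤ n → n ≤ N → ∀ v ∈ S,
    inner ℝ (fn (l1Deriv t P.α u n)) (fn v) + P.a (t n) (u n) v =
      P.lam * (∫ x in (P.Ω : Set (Pt d)), P.intOp (fn (m.extrap t u n)) x * fn v x) +
        inner ℝ (f (t n)) (fn v)

end IMEXL1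

end

/-!
# Stability of the IMEX-L1 finite element method in the `L²` norm

Testing the scheme with its solution `uⁿ` reduces the theorem to a scalar problem. The kernels
`K^{n,j}` are positive and increase with `j`, so `‖uⁿ‖ D‖uⁿ‖ ≤ (D uⁿ, uⁿ)`
(`norm_mul_l1Deriv_norm_le`). Coercivity, Young's inequality and the bounds for the lower order and
integral terms then give `D‖uⁿ‖ ≤ Λ₀ max_{k ≤ n} ‖uᵏ‖ + ‖fⁿ‖`
(`IsDiscreteSolution.l1Deriv_norm_le`), in which the extrapolation only enters through the running
maximum.

The complementary kernels satisfy `∑_{j=k}^n P^{n,j} K^{j,k} = 1`, so summing against them inverts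
`D`, and what remains is a discrete fractional Gronwall inequality
(`le_two_mul_mittagLeffler_of_l1Deriv_le`). If `‖uⁿ‖` does not exceed an earlier norm, the bound is
inherited. Otherwise the running maximum is `‖uⁿ‖` itself, the step size restriction
`Λ₀ P^{n,n} ≤ 1/2` absorbs the diagonal term, and induction closes with
`μ ∑_{j<n} P^{n,j} E_α(μ t_j^α) ≤ E_α(μ t_n^α) - 1`
(`mul_sum_complKernel_mul_mittagLeffler_le`), `μ = 2 Λ₀`.

The last inequality is proved for each term of the power series. With `q = (m + 1) α` it says that
`∑_{j<n} P^{n,j} k_{1-α+q}(t_j) ≤ k_{q+1}(t_n)`, where `k_{1-α+q} = k_{1-α} * k_q` by the Beta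
integral and `k_q` is the derivative of `k_{q+1}` (`sum_complKernel_mul_kern_le`). On each cell, if
`q ≤ 1`, then `k_q` is decreasing and Chebyshev's integral inequality compares the integral with
`K^{j,k}` times the increment of `k_{q+1}`. If `q ≥ 1`, then `k_q` is increasing and the increment
over the following cell, which is no shorter on a graded mesh, takes over that role.
-/

namespace IMEXL1

/-! ### Fractional kernels -/

theorem kern_nonneg {β x : ℝ} (hβ : 0 < β) (hx : 0 ≤ x) : 0 ≤ kern β x :=
  div_nonneg (Real.rpow_nonneg hx _) (Real.Gamma_pos_of_pos hβ).le

theorem kern_pos {β x : ℝ} (hβ : 0 < β) (hx : 0 < x) : 0 < kern β x :=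
  div_pos (Real.rpow_pos_of_pos hx _) (Real.Gamma_pos_of_pos hβ)

theorem kern_zero {β : ℝ} (hβ : β ≠ 1) : kern β 0 = 0 := by
  rw [kern, Real.zero_rpow (sub_ne_zero.mpr hβ), zero_div]

theorem kern_le_kern {β x y : ℝ} (hβ : 1 ≤ β) (hx : 0 ≤ x) (hxy : x ≤ y) :
    kern β x ≤ kern β y :=
  div_le_div_of_nonneg_right (Real.rpow_le_rpow hx hxy (by linarith))
    (Real.Gamma_pos_of_pos (by linarith)).le

theorem kern_lt_kern {β x y : ℝ} (hβ : 1 < β) (hx : 0 ≤ x) (hxy : x < y) :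
    kern β x < kern β y :=
  div_lt_div_of_pos_right (Real.rpow_lt_rpow hx hxy (by linarith))
    (Real.Gamma_pos_of_pos (by linarith))

theorem kern_anti {β x y : ℝ} (hβ : 0 < β) (hβ1 : β ≤ 1) (hx : 0 < x) (hxy : x ≤ y) :
    kern β y ≤ kern β x :=
  div_le_div_of_nonneg_right (Real.rpow_le_rpow_of_nonpos hx hxy (by linarith))
    (Real.Gamma_pos_of_pos hβ).le

theorem concaveOn_kern {β : ℝ} (h1 : 1 ≤ β) (h2 : β ≤ 2) :
    ConcaveOn ℝ (Set.Ici 0) (kern β) := by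
  have h := (Real.concaveOn_rpow (p := β - 1) (by linarith) (by linarith)).smul
    (inv_nonneg.mpr (Real.Gamma_pos_of_pos (by linarith : 0 < β)).le)
  refine h.congr fun x _ => ?_
  simp only [kern, smul_eq_mul, div_eq_inv_mul]

theorem hasDerivAt_kern {β x : ℝ} (hβ : 0 < β) (hx : 0 < x) :
    HasDerivAt (kern (β + 1)) (kern β x) x := by
  have h := (Real.hasDerivAt_rpow_const (x := x) (p := β) (Or.inl hx.ne')).div_const
    (Real.Gamma (β + 1))
  have e : kern (β + 1) = fun y => y ^ β / Real.Gamma (β + 1) := by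
    funext y
    rw [kern, add_sub_cancel_right]
  rw [e]
  refine h.congr_deriv ?_
  rw [kern, Real.Gamma_add_one hβ.ne', mul_div_mul_left _ _ hβ.ne']

theorem continuous_kern {β : ℝ} (hβ : 1 ≤ β) : Continuous (kern β) :=
  (Real.continuous_rpow_const (by linarith)).div_const _

theorem intervalIntegrable_kern {β : ℝ} (hβ : 0 < β) (a b : ℝ) :
    IntervalIntegrable (kern β) volume a b :=
  (intervalIntegral.intervalIntegrable_rpow' (by linarith)).div_const _

theorem intervalIntegrable_kern_sub {β : ℝ} (hβ : 0 < β) (T a b : ℝ) :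
    IntervalIntegrable (fun s => kern β (T - s)) volume a b := by
  have h := (intervalIntegrable_kern hβ (T - a) (T - b)).comp_sub_left T
  simpa using h

theorem integral_kern {β : ℝ} (hβ : 0 < β) (a b : ℝ) :
    ∫ s in a..b, kern β s = kern (β + 1) b - kern (β + 1) a := by
  simp only [kern, intervalIntegral.integral_div]
  rw [integral_rpow (Or.inl (by linarith)), Real.Gamma_add_one hβ.ne', sub_add_cancel,
    add_sub_cancel_right, div_div, sub_div]

theorem integral_kern_sub {β : ℝ} (hβ : 0 < β) (T a b : ℝ) :
    ∫ s in a..b, kern β (T - s) = kern (β + 1) (T - a) - kern (β + 1) (T - b) := by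
  rw [intervalIntegral.integral_comp_sub_left (kern β), integral_kern hβ]

/-- The semigroup law `k_p * k_q = k_{p+q}` for the fractional kernels, which is the evaluation of
the Beta integral. -/
theorem integral_kern_mul_kern {p q a : ℝ} (hp : 0 < p) (hq : 0 < q) (ha : 0 < a) :
    ∫ s in 0..a, kern p (a - s) * kern q s = kern (p + q) a := by
  have hc := Complex.betaIntegral_scaled (q : ℂ) (p : ℂ) ha
  rw [Complex.betaIntegral_eq_Gamma_mul_div _ _ (by simpa) (by simpa)] at hc
  have e : ∫ x in 0..a, (x : ℂ) ^ ((q : ℂ) - 1) * ((a : ℂ) - x) ^ ((p : ℂ) - 1) =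
      ((∫ x in 0..a, x ^ (q - 1) * (a - x) ^ (p - 1) : ℝ) : ℂ) := by
    rw [← intervalIntegral.integral_ofReal]
    refine intervalIntegral.integral_congr fun x hx => ?_
    rw [Set.uIcc_of_le ha.le] at hx
    rw [Complex.ofReal_mul, Complex.ofReal_cpow hx.1, Complex.ofReal_cpow (sub_nonneg.mpr hx.2)]
    push_cast
    rfl
  have e2 : (a : ℂ) ^ ((q : ℂ) + p - 1) *
      (Complex.Gamma q * Complex.Gamma p / Complex.Gamma (q + p)) =
      ((a ^ (q + p - 1) * (Real.Gamma q * Real.Gamma p / Real.Gamma (q + p)) : ℝ) : ℂ) := by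
    rw [Complex.ofReal_mul, Complex.ofReal_cpow ha.le, Complex.ofReal_div, Complex.ofReal_mul,
      ← Complex.Gamma_ofReal, ← Complex.Gamma_ofReal, ← Complex.Gamma_ofReal]
    push_cast
    rfl
  rw [e, e2, Complex.ofReal_inj] at hc
  have e3 : ∀ s : ℝ, kern p (a - s) * kern q s =
      s ^ (q - 1) * (a - s) ^ (p - 1) / (Real.Gamma q * Real.Gamma p) := by
    intro s
    rw [kern, kern, div_mul_div_comm, mul_comm ((a - s) ^ _), mul_comm (Real.Gamma p)]
  have h1 := (Real.Gamma_pos_of_pos hp).ne'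
  have h2 := (Real.Gamma_pos_of_pos hq).ne'
  simp only [e3]
  rw [intervalIntegral.integral_div, hc, kern, add_comm q p]
  field_simp

theorem intervalIntegrable_kern_mul_kern {p q a : ℝ} (hp : 0 < p) (hq : 0 < q) (ha : 0 < a) :
    IntervalIntegrable (fun s => kern p (a - s) * kern q s) volume 0 a := by
  -- A non-integrable function would have integral `0`, but the value is positive.
  by_contra h
  have h0 := intervalIntegral.integral_undef h
  rw [integral_kern_mul_kern hp hq ha] at h0
  exact (kern_pos (add_pos hp hq) ha).ne' h0

/-- Chebyshev's integral inequality for an increasing kernel `s ↦ k_p(T - s)` and a decreasing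
kernel `k_q`: the integral of the product is at most the product of the integrals divided by the
length of the interval. -/
theorem integral_kern_mul_kern_le {p q T a b : ℝ} (hp : 0 < p) (hp1 : p ≤ 1) (hq : 0 < q)
    (hq1 : q ≤ 1) (ha : 0 ≤ a) (hab : a < b) (hbT : b ≤ T)
    (hint : IntervalIntegrable (fun s => kern p (T - s) * kern q s) volume a b) :
    ∫ s in a..b, kern p (T - s) * kern q s ≤
      1 / (b - a) * (∫ s in a..b, kern p (T - s)) * ∫ s in a..b, kern q s := by
  have hba : 0 < b - a := sub_pos.mpr hab
  -- The increasing factor attains its mean value at an interior point `c`.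
  obtain ⟨c, hc, hcm⟩ : ∃ c ∈ Set.Ioo a b, kern p (T - c) =
      (∫ s in a..b, kern p (T - s)) / (b - a) := by
    obtain ⟨c, hc, h⟩ := exists_hasDerivAt_eq_slope (fun s => -kern (p + 1) (T - s))
      (fun s => kern p (T - s)) hab
      (((continuous_kern (by linarith)).comp (continuous_const.sub continuous_id)).neg.continuousOn)
      (fun x hx => by
        have h := ((hasDerivAt_kern hp (x := T - x) (by linarith [hx.2])).comp x
          ((hasDerivAt_id x).const_sub T)).neg
        exact h.congr_deriv (by simp))
    refine ⟨c, hc, ?_⟩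
    rw [h, integral_kern_sub hp]
    congr 1
    ring
  have i1 := intervalIntegrable_kern_sub hp T a b
  have i2 := intervalIntegrable_kern hq a b
  have hle : ∫ s in a..b, kern p (T - s) * kern q s ≤
      ∫ s in a..b, (kern p (T - c) * kern q s + kern q c * kern p (T - s)
        - kern p (T - c) * kern q c) := by
    refine intervalIntegral.integral_mono_on_of_le_Ioo hab.le hint
      (((i2.const_mul _).add (i1.const_mul _)).sub intervalIntegrable_const) fun s hs => ?_
    rcases le_total s c with h | h
    · have h1 := kern_anti hp hp1 (x := T - c) (y := T - s) (by linarith [hc.2]) (by linarith)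
      have h2 := kern_anti hq hq1 (x := s) (y := c) (by linarith [hs.1]) h
      nlinarith
    · have h1 := kern_anti hp hp1 (x := T - s) (y := T - c) (by linarith [hs.2]) (by linarith)
      have h2 := kern_anti hq hq1 (x := c) (y := s) (by linarith [hc.1]) h
      nlinarith
  refine hle.trans (le_of_eq ?_)
  rw [intervalIntegral.integral_sub ((i2.const_mul _).add (i1.const_mul _))
      intervalIntegrable_const, intervalIntegral.integral_add (i2.const_mul _) (i1.const_mul _),
    intervalIntegral.integral_const_mul, intervalIntegral.integral_const_mul,
    intervalIntegral.integral_const, hcm, smul_eq_mul]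
  field_simp
  ring

/-! ### The Mittag-Leffler function -/

theorem rpow_mul_exp_neg_le_Gamma {R x : ℝ} (hR : 0 ≤ R) (hx : 1 ≤ x) :
    R ^ (x - 1) * Real.exp (-R) ≤ Real.Gamma x := by
  have hint := Real.GammaIntegral_convergent (s := x) (by linarith)
  rw [Real.Gamma_eq_integral (by linarith), ← integral_exp_neg_Ioi, ← integral_const_mul]
  refine le_trans ?_ (setIntegral_mono_set (s := Set.Ioi R) hint ?_
    (Set.Ioi_subset_Ioi hR).eventuallyLE)
  · refine setIntegral_mono_on ((integrableOn_exp_neg_Ioi R).const_mul _)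
      (hint.mono_set (Set.Ioi_subset_Ioi hR)) measurableSet_Ioi fun y hy => ?_
    rw [mul_comm]
    exact mul_le_mul_of_nonneg_left (Real.rpow_le_rpow hR (le_of_lt hy) (by linarith))
      (Real.exp_pos _).le
  · filter_upwards [ae_restrict_mem measurableSet_Ioi] with y hy
    exact mul_nonneg (Real.exp_pos _).le (Real.rpow_nonneg (le_of_lt hy) _)

theorem mittagLeffler_term_nonneg {α z : ℝ} (hα : 0 < α) (hz : 0 ≤ z) (k : ℕ) :
    0 ≤ z ^ k / Real.Gamma (α * k + 1) :=
  div_nonneg (pow_nonneg hz k) (Real.Gamma_pos_of_pos (by positivity)).le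

theorem summable_mittagLeffler {α z : ℝ} (hα : 0 < α) (hz : 0 ≤ z) :
    Summable fun k : ℕ => z ^ k / Real.Gamma (α * k + 1) := by
  -- With `R ^ α = 2 z + 1`, the bound `R ^ (α k) e ^ (-R) ≤ Γ (α k + 1)` gives a geometric
  -- majorant of ratio `z / (2 z + 1) < 1`.
  set w : ℝ := 2 * z + 1 with hw
  have hwpos : 0 < w := by positivity
  set R : ℝ := w ^ (1 / α) with hR
  have hRpos : 0 < R := Real.rpow_pos_of_pos hwpos _
  have hRα : ∀ k : ℕ, R ^ (α * k) = w ^ k := by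
    intro k
    rw [hR, ← Real.rpow_mul hwpos.le, ← mul_assoc, one_div_mul_cancel hα.ne', one_mul,
      Real.rpow_natCast]
  have hgeo : Summable fun k : ℕ => Real.exp R * (z / w) ^ k :=
    (summable_geometric_of_lt_one (by positivity)
      ((div_lt_one hwpos).mpr (by linarith))).mul_left _
  refine Summable.of_nonneg_of_le (mittagLeffler_term_nonneg hα hz) (fun k => ?_) hgeo
  have hG := rpow_mul_exp_neg_le_Gamma hRpos.le
    (show (1 : ℝ) ≤ α * k + 1 from le_add_of_nonneg_left (by positivity))
  rw [add_sub_cancel_right, hRα, Real.exp_neg] at hG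
  have hpos : 0 < w ^ k * (Real.exp R)⁻¹ := by positivity
  calc z ^ k / Real.Gamma (α * k + 1) ≤ z ^ k / (w ^ k * (Real.exp R)⁻¹) :=
        div_le_div_of_nonneg_left (pow_nonneg hz k) hpos hG
    _ = Real.exp R * (z / w) ^ k := by
        rw [div_pow]
        field_simp

theorem mittagLeffler_eq_one_add {α z : ℝ} (hα : 0 < α) (hz : 0 ≤ z) :
    mittagLeffler α z = 1 + ∑' k : ℕ, z ^ (k + 1) / Real.Gamma (α * (k + 1 : ℕ) + 1) := by
  rw [mittagLeffler, (summable_mittagLeffler hα hz).tsum_eq_zero_add]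
  simp

theorem one_le_mittagLeffler {α z : ℝ} (hα : 0 < α) (hz : 0 ≤ z) : 1 ≤ mittagLeffler α z := by
  rw [mittagLeffler_eq_one_add hα hz]
  exact le_add_of_nonneg_right (tsum_nonneg fun k => mittagLeffler_term_nonneg hα hz (k + 1))

theorem mittagLeffler_mono {α z w : ℝ} (hα : 0 < α) (hz : 0 ≤ z) (hzw : z ≤ w) :
    mittagLeffler α z ≤ mittagLeffler α w :=
  (summable_mittagLeffler hα hz).tsum_le_tsum
    (fun k => div_le_div_of_nonneg_right (pow_le_pow_left₀ hz hzw k)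
      (Real.Gamma_pos_of_pos (by positivity)).le)
    (summable_mittagLeffler hα (hz.trans hzw))

/-! ### The discrete kernels on a mesh with increasing nodes -/

theorem step_pos {t : ℕ → ℝ} (ht : StrictMono t) {n : ℕ} (hn : 1 ≤ n) : 0 < step t n :=
  sub_pos.mpr (ht (by omega))

theorem discKernel_eq {t : ℕ → ℝ} {α : ℝ} (hα1 : α < 1) (n j : ℕ) :
    discKernel t (1 - α) n j =
      (kern (2 - α) (t n - t (j - 1)) - kern (2 - α) (t n - t j)) / step t j := by
  rw [discKernel, integral_kern_sub (by linarith), show 1 - α + 1 = 2 - α by ring, one_div,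
    inv_mul_eq_div]

theorem discKernel_pos {t : ℕ → ℝ} (ht : StrictMono t) {α : ℝ} (hα1 : α < 1) {n j : ℕ}
    (hj : 1 ≤ j) (hjn : j ≤ n) : 0 < discKernel t (1 - α) n j := by
  rw [discKernel_eq hα1]
  refine div_pos (sub_pos.mpr (kern_lt_kern (by linarith) ?_ ?_)) (step_pos ht hj)
  · exact sub_nonneg.mpr (ht.monotone hjn)
  · exact sub_lt_sub_left (ht (by omega)) _

/-- The kernels `K^{n,j}` increase with `j`: they are difference quotients of the concave function
`k_{2-α}`. -/
theorem discKernel_le_succ {t : ℕ → ℝ} (ht : StrictMono t) {α : ℝ} (hα : 0 < α) (hα1 : α < 1)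
    {n j : ℕ} (hj : 1 ≤ j) (hjn : j < n) :
    discKernel t (1 - α) n j ≤ discKernel t (1 - α) n (j + 1) := by
  have h1 : t (j + 1) ≤ t n := ht.monotone hjn
  have h2 : t j < t (j + 1) := ht (by omega)
  have h3 : t (j - 1) < t j := ht (by omega)
  have h := (concaveOn_kern (β := 2 - α) (by linarith) (by linarith)).slope_anti_adjacent
    (x := t n - t (j + 1)) (y := t n - t j) (z := t n - t (j - 1))
    (Set.mem_Ici.mpr (by linarith)) (Set.mem_Ici.mpr (by linarith)) (by linarith) (by linarith)
  rw [sub_sub_sub_cancel_left, sub_sub_sub_cancel_left] at h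
  rw [discKernel_eq hα1, discKernel_eq hα1, Nat.add_sub_cancel, step, step, Nat.add_sub_cancel]
  exact h

theorem discKernel_self {t : ℕ → ℝ} (ht : StrictMono t) {α : ℝ} (hα1 : α < 1) {n : ℕ}
    (hn : 1 ≤ n) :
    discKernel t (1 - α) n n = (step t n ^ α * Real.Gamma (2 - α))⁻¹ := by
  have hs := step_pos ht hn
  rw [discKernel_eq hα1, sub_self, kern_zero (by linarith), sub_zero, ← step, kern,
    show 2 - α - 1 = 1 - α by ring, Real.rpow_sub hs, Real.rpow_one]
  have := (Real.rpow_pos_of_pos hs α).ne'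
  field_simp

theorem complKernel_self {t : ℕ → ℝ} {α : ℝ} (n : ℕ) :
    complKernel t α n n = 1 / discKernel t (1 - α) n n := by
  rw [complKernel, if_neg (lt_irrefl n), mul_one]

theorem complKernel_of_lt {t : ℕ → ℝ} {α : ℝ} {n i : ℕ} (h : i < n) :
    complKernel t α n i = 1 / discKernel t (1 - α) i i *
      ∑ j ∈ Finset.Icc (i + 1) n, complKernel t α n j *
        (discKernel t (1 - α) j (i + 1) - discKernel t (1 - α) j i) := by
  rw [complKernel, if_pos h]
  congr 1
  exact Finset.sum_coe_sort (Finset.Icc (i + 1) n) fun j => complKernel t α n j *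
    (discKernel t (1 - α) j (i + 1) - discKernel t (1 - α) j i)

theorem complKernel_nonneg {t : ℕ → ℝ} (ht : StrictMono t) {α : ℝ} (hα : 0 < α) (hα1 : α < 1)
    {n i : ℕ} (hi : 1 ≤ i) (hin : i ≤ n) : 0 ≤ complKernel t α n i := by
  induction h : n - i using Nat.strong_induction_on generalizing i with
  | _ d ih =>
    have hK := (one_div_pos.mpr (discKernel_pos ht hα1 hi le_rfl)).le
    rcases hin.eq_or_lt with rfl | hlt
    · rwa [complKernel_self]
    · rw [complKernel_of_lt hlt]
      refine mul_nonneg hK (Finset.sum_nonneg fun j hj => ?_)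
      obtain ⟨h1, h2⟩ := Finset.mem_Icc.mp hj
      exact mul_nonneg (ih (n - j) (by omega) (by omega) h2 rfl)
        (sub_nonneg.mpr (discKernel_le_succ ht hα hα1 hi (by omega)))

/-- The complementary kernels invert the discrete convolution: `∑_{j=k}^n P^{n,j} K^{j,k} = 1`. -/
theorem sum_complKernel_mul_discKernel {t : ℕ → ℝ} (ht : StrictMono t) {α : ℝ} (hα1 : α < 1)
    {n k : ℕ} (hk : 1 ≤ k) (hkn : k ≤ n) :
    ∑ j ∈ Finset.Icc k n, complKernel t α n j * discKernel t (1 - α) j k = 1 := by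
  induction h : n - k generalizing k with
  | zero =>
    obtain rfl : k = n := by omega
    rw [Finset.Icc_self, Finset.sum_singleton, complKernel_self,
      one_div_mul_cancel (discKernel_pos ht hα1 hk le_rfl).ne']
  | succ d ih =>
    have hlt : k < n := by omega
    have hK := (discKernel_pos ht hα1 hk le_rfl).ne'
    rw [Finset.Icc_eq_cons_Ioc hkn, Finset.sum_cons, ← Finset.Icc_add_one_left_eq_Ioc,
      complKernel_of_lt hlt]
    refine Eq.trans ?_ (ih (k := k + 1) (by omega) hlt (by omega))
    rw [mul_right_comm, one_div_mul_cancel hK, one_mul]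
    simp only [mul_sub, Finset.sum_sub_distrib]
    exact sub_add_cancel _ _

theorem sum_complKernel_mul_sum {t : ℕ → ℝ} (ht : StrictMono t) {α : ℝ} (hα1 : α < 1) (n : ℕ)
    (w : ℕ → ℝ) :
    ∑ j ∈ Finset.Icc 1 n, complKernel t α n j *
      ∑ k ∈ Finset.Icc 1 j, discKernel t (1 - α) j k * w k = ∑ k ∈ Finset.Icc 1 n, w k := by
  simp only [Finset.mul_sum]
  rw [Finset.sum_comm' (t' := Finset.Icc 1 n) (s' := fun k => Finset.Icc k n)
    (by intro x y; simp only [Finset.mem_Icc]; omega)]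
  refine Finset.sum_congr rfl fun k hk => ?_
  obtain ⟨h1, h2⟩ := Finset.mem_Icc.mp hk
  simp only [← mul_assoc]
  rw [← Finset.sum_mul, sum_complKernel_mul_discKernel ht hα1 h1 h2, one_mul]

/-- The complementary kernels integrate the L1 formula: `∑_{j=1}^n P^{n,j} D x^j = x^n - x^0`. -/
theorem sum_complKernel_mul_l1Deriv {t : ℕ → ℝ} (ht : StrictMono t) {α : ℝ} (hα1 : α < 1) (n : ℕ)
    (x : ℕ → ℝ) :
    ∑ j ∈ Finset.Icc 1 n, complKernel t α n j * l1Deriv t α x j = x n - x 0 := by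
  simp only [l1Deriv, smul_eq_mul]
  rw [sum_complKernel_mul_sum ht hα1 n fun k => x k - x (k - 1)]
  induction n with
  | zero => simp
  | succ n ih => rw [Finset.sum_Icc_succ_top (by omega), ih, Nat.add_sub_cancel]; ring

/-! ### Complementary kernels and the Mittag-Leffler function -/

/-- Here `k_{1-α+q}(t_j)` is the integral of `k_{1-α}(t_j - s) k_q(s)` over `(0, t_j)`. If its
part over each cell `k` is at most `K^{j,k} w_k`, then the identity `∑_j P^{n,j} K^{j,k} = 1` bounds
its complementary sum by the sum of the `w_k`. -/
theorem sum_complKernel_mul_integral_le {t : ℕ → ℝ} (ht : StrictMono t) (ht0 : t 0 = 0) {α q : ℝ}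
    (hα : 0 < α) (hα1 : α < 1) (hq : 0 < q) (n : ℕ) (w : ℕ → ℝ)
    (hw : ∀ k, 1 ≤ k → k < n → 0 ≤ w k)
    (hle : ∀ j k, 1 ≤ k → k ≤ j → j < n →
      IntervalIntegrable (fun s => kern (1 - α) (t j - s) * kern q s) volume (t (k - 1)) (t k) →
      ∫ s in (t (k - 1))..(t k), kern (1 - α) (t j - s) * kern q s ≤
        discKernel t (1 - α) j k * w k) :
    ∑ j ∈ Finset.Ico 1 n, complKernel t α n j * kern (1 - α + q) (t j) ≤
      ∑ k ∈ Finset.Ico 1 n, w k := by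
  have hcell : ∀ j, 1 ≤ j → j < n → kern (1 - α + q) (t j) ≤
      ∑ k ∈ Finset.Icc 1 j, discKernel t (1 - α) j k * w k := by
    intro j hj hjn
    have hpos : 0 < t j := ht0 ▸ ht (show 0 < j by omega)
    have hi := intervalIntegrable_kern_mul_kern (p := 1 - α) (by linarith) hq hpos
    have hi' : ∀ k < j, IntervalIntegrable (fun s => kern (1 - α) (t j - s) * kern q s) volume
        (t k) (t (k + 1)) := by
      intro k hk
      refine hi.mono_set ?_
      rw [Set.uIcc_of_le (ht.monotone (Nat.le_succ k)), Set.uIcc_of_le hpos.le]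
      exact Set.Icc_subset_Icc (ht0 ▸ ht.monotone (Nat.zero_le k)) (ht.monotone hk)
    have hsum := intervalIntegral.sum_integral_adjacent_intervals hi'
    rw [ht0, integral_kern_mul_kern (by linarith) hq hpos] at hsum
    rw [← hsum, ← Finset.Ico_add_one_right_eq_Icc, Finset.range_eq_Ico,
      ← Finset.sum_Ico_add' (fun k => discKernel t (1 - α) j k * w k) 0 j 1]
    refine Finset.sum_le_sum fun k hk => ?_
    have hkj := (Finset.mem_Ico.mp hk).2
    exact hle j (k + 1) (by omega) hkj hjn (hi' k hkj)
  calc ∑ j ∈ Finset.Ico 1 n, complKernel t α n j * kern (1 - α + q) (t j)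
      ≤ ∑ j ∈ Finset.Ico 1 n, complKernel t α n j *
          ∑ k ∈ Finset.Icc 1 j, discKernel t (1 - α) j k * w k := by
        refine Finset.sum_le_sum fun j hj => ?_
        obtain ⟨h1, h2⟩ := Finset.mem_Ico.mp hj
        exact mul_le_mul_of_nonneg_left (hcell j h1 h2)
          (complKernel_nonneg ht hα hα1 h1 h2.le)
    _ = ∑ k ∈ Finset.Ico 1 n,
          (∑ j ∈ Finset.Ico k n, complKernel t α n j * discKernel t (1 - α) j k) * w k := by
        simp only [Finset.mul_sum, Finset.sum_mul, ← mul_assoc]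
        exact Finset.sum_comm' (by intro x y; simp only [Finset.mem_Icc, Finset.mem_Ico]; omega)
    _ ≤ ∑ k ∈ Finset.Ico 1 n, w k := by
        refine Finset.sum_le_sum fun k hk => ?_
        obtain ⟨h1, h2⟩ := Finset.mem_Ico.mp hk
        refine mul_le_of_le_one_left (hw k h1 h2) ?_
        refine le_of_le_of_eq ?_ (sum_complKernel_mul_discKernel ht hα1 h1 h2.le)
        refine Finset.sum_le_sum_of_subset_of_nonneg Finset.Ico_subset_Icc_self fun j hj _ => ?_
        obtain ⟨h3, h4⟩ := Finset.mem_Icc.mp hj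
        exact mul_nonneg (complKernel_nonneg ht hα hα1 (h1.trans h3) h4)
          (discKernel_pos ht hα1 h1 h3).le

/-- The complementary convolution, without its diagonal term, maps the Caputo derivative
`k_{1-α+q}` of `k_{q+1}` to at most `k_{q+1}` itself. The function `k_{q+1}` is concave for `q ≤ 1`
and convex for `q ≥ 1`, and in both cases the contributions of the cells are dominated by increments
of `k_{q+1}`, which telescope. -/
theorem sum_complKernel_mul_kern_le {t : ℕ → ℝ} (ht : StrictMono t) (ht0 : t 0 = 0)
    (hconv : ∀ n, 1 ≤ n → step t n ≤ step t (n + 1)) {α q : ℝ}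
    (hα : 0 < α) (hα1 : α < 1) (hq : 0 < q) {n : ℕ} (hn : 1 ≤ n) :
    ∑ j ∈ Finset.Ico 1 n, complKernel t α n j * kern (1 - α + q) (t j) ≤ kern (q + 1) (t n) := by
  have htn : ∀ k, 0 ≤ t k := fun k => ht0 ▸ ht.monotone (Nat.zero_le k)
  have hmono : Monotone fun k => kern (q + 1) (t k) := fun a b hab =>
    kern_le_kern (by linarith) (htn a) (ht.monotone hab)
  rcases le_total q 1 with hq1 | hq1
  · -- The derivative `k_q` is decreasing.
    refine (sum_complKernel_mul_integral_le ht ht0 hα hα1 hq n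
      (fun k => kern (q + 1) (t k) - kern (q + 1) (t (k - 1)))
      (fun k _ _ => sub_nonneg.mpr (hmono (Nat.sub_le k 1))) ?_).trans ?_
    · intro j k hk hkj _ hint
      have h := integral_kern_mul_kern_le (by linarith) (by linarith) hq hq1 (htn (k - 1))
        (ht (show k - 1 < k by omega)) (ht.monotone hkj) hint
      rw [integral_kern hq] at h
      exact h
    · rw [Finset.sum_Ico_eq_sum_range]
      simp only [Nat.add_sub_cancel_left]
      simp only [add_comm 1]
      rw [Finset.sum_range_sub fun k => kern (q + 1) (t k)]
      exact (sub_le_self _ (kern_nonneg (by linarith) (htn 0))).trans (hmono (Nat.sub_le n 1))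
  · -- The derivative `k_q` is increasing: its maximum over a cell is at most its mean over the
    -- next cell, and the next cell is not shorter.
    refine (sum_complKernel_mul_integral_le ht ht0 hα hα1 hq n
      (fun k => step t k * kern q (t k))
      (fun k hk _ => mul_nonneg (step_pos ht hk).le (kern_nonneg hq (htn k))) ?_).trans ?_
    · intro j k hk hkj _ hint
      have hs := (step_pos ht hk).ne'
      have hlt : t (k - 1) < t k := ht (by omega)
      calc ∫ s in (t (k - 1))..(t k), kern (1 - α) (t j - s) * kern q s
          ≤ ∫ s in (t (k - 1))..(t k), kern (1 - α) (t j - s) * kern q (t k) := by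
            refine intervalIntegral.integral_mono_on hlt.le hint
              ((intervalIntegrable_kern_sub (by linarith) _ _ _).mul_const _) fun s hs => ?_
            have hsj : s ≤ t j := hs.2.trans (ht.monotone hkj)
            exact mul_le_mul_of_nonneg_left
              (kern_le_kern hq1 ((htn _).trans hs.1) hs.2)
              (kern_nonneg (by linarith) (by linarith))
        _ = discKernel t (1 - α) j k * (step t k * kern q (t k)) := by
            rw [intervalIntegral.integral_mul_const, discKernel]
            field_simp
    · calc ∑ k ∈ Finset.Ico 1 n, step t k * kern q (t k)
          ≤ ∑ k ∈ Finset.Ico 1 n, (kern (q + 1) (t (k + 1)) - kern (q + 1) (t k)) := by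
            refine Finset.sum_le_sum fun k hk => ?_
            have h1 := (Finset.mem_Ico.mp hk).1
            rw [← integral_kern hq]
            calc step t k * kern q (t k) ≤ step t (k + 1) * kern q (t k) :=
                  mul_le_mul_of_nonneg_right (hconv k h1) (kern_nonneg hq (htn k))
              _ = ∫ s in (t k)..(t (k + 1)), kern q (t k) := by
                  rw [intervalIntegral.integral_const, smul_eq_mul, step, Nat.add_sub_cancel]
              _ ≤ ∫ s in (t k)..(t (k + 1)), kern q s :=
                  intervalIntegral.integral_mono_on (ht.monotone (Nat.le_succ k))
                    intervalIntegrable_const (intervalIntegrable_kern hq _ _)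
                    fun s hs => kern_le_kern hq1 (htn k) hs.1
        _ = kern (q + 1) (t n) - kern (q + 1) (t 1) :=
            Finset.sum_Ico_sub (fun k => kern (q + 1) (t k)) hn
        _ ≤ kern (q + 1) (t n) := sub_le_self _ (kern_nonneg (by linarith) (htn 1))

/-- Discrete counterpart of the fractional integral equation `E = 1 + μ (k_α * E)` satisfied by
`t ↦ E_α(μ t^α)`, as an inequality; the diagonal term `j = n` is left out. It is proved term by term
in the power series of `E_α`. -/
theorem mul_sum_complKernel_mul_mittagLeffler_le {t : ℕ → ℝ} (ht : StrictMono t) (ht0 : t 0 = 0)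
    (hconv : ∀ n, 1 ≤ n → step t n ≤ step t (n + 1)) {α μ : ℝ}
    (hα : 0 < α) (hα1 : α < 1) (hμ : 0 ≤ μ) {n : ℕ} (hn : 1 ≤ n) :
    μ * ∑ j ∈ Finset.Ico 1 n, complKernel t α n j * mittagLeffler α (μ * t j ^ α) ≤
      mittagLeffler α (μ * t n ^ α) - 1 := by
  have htn : ∀ k, 0 ≤ t k := fun k => ht0 ▸ ht.monotone (Nat.zero_le k)
  have hz : ∀ k, 0 ≤ μ * t k ^ α := fun k => mul_nonneg hμ (Real.rpow_nonneg (htn k) _)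
  have hterm : ∀ j m : ℕ, (μ * t j ^ α) ^ m / Real.Gamma (α * m + 1) =
      μ ^ m * kern (α * m + 1) (t j) := by
    intro j m
    rw [kern, add_sub_cancel_right, mul_pow, Real.rpow_mul (htn j), Real.rpow_natCast,
      mul_div_assoc]
  have hs : ∀ j, Summable fun m : ℕ => μ ^ m * kern (α * m + 1) (t j) := fun j => by
    simpa only [hterm] using summable_mittagLeffler hα (hz j)
  rw [mittagLeffler_eq_one_add hα (hz n), add_sub_cancel_left]
  simp only [mittagLeffler, hterm]
  have hsP : ∀ j ∈ Finset.Ico 1 n, Summable fun m : ℕ =>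
      complKernel t α n j * (μ ^ m * kern (α * m + 1) (t j)) := fun j _ => (hs j).mul_left _
  simp only [← tsum_mul_left]
  rw [← Summable.tsum_finsetSum hsP, ← tsum_mul_left]
  refine Summable.tsum_le_tsum (fun m => ?_) ((summable_sum hsP).mul_left μ)
    ((summable_nat_add_iff 1).mpr (hs n))
  have h := sum_complKernel_mul_kern_le ht ht0 hconv hα hα1 (q := α * (m + 1 : ℕ))
    (by positivity) hn
  rw [show 1 - α + α * (m + 1 : ℕ) = α * m + 1 by push_cast; ring] at h
  calc μ * ∑ j ∈ Finset.Ico 1 n, complKernel t α n j * (μ ^ m * kern (α * m + 1) (t j))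
      = μ ^ (m + 1) * ∑ j ∈ Finset.Ico 1 n, complKernel t α n j * kern (α * m + 1) (t j) := by
        simp only [Finset.mul_sum]
        exact Finset.sum_congr rfl fun j _ => by ring
    _ ≤ μ ^ (m + 1) * kern (α * (m + 1 : ℕ) + 1) (t n) :=
        mul_le_mul_of_nonneg_left h (pow_nonneg hμ _)

/-! ### A discrete fractional Gronwall inequality -/

/-- Discrete fractional Gronwall inequality, where `D x^n` is bounded in terms of the running maximum
of `x`. At a level where `x` exceeds all its earlier values the running maximum is `x n`, and
`μ P^{n,n} ≤ 1/2` absorbs the diagonal term; at every other level the bound is inherited from an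
earlier one. -/
theorem le_two_mul_mittagLeffler_of_l1Deriv_le {t : ℕ → ℝ} (ht : StrictMono t) (ht0 : t 0 = 0)
    (hconv : ∀ n, 1 ≤ n → step t n ≤ step t (n + 1)) {α μ : ℝ}
    (hα : 0 < α) (hα1 : α < 1) (hμ : 0 ≤ μ) {N : ℕ} {x F : ℕ → ℝ} {G : ℝ}
    (hx : ∀ n, 0 ≤ x n)
    (hstep : ∀ n, 1 ≤ n → n ≤ N → μ * complKernel t α n n ≤ 1 / 2)
    (hD : ∀ n, 1 ≤ n → n ≤ N → ∀ M, (∀ k ≤ n, x k ≤ M) → l1Deriv t α x n ≤ μ * M + F n)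
    (hG0 : x 0 ≤ G)
    (hG : ∀ n, 1 ≤ n → n ≤ N →
      x 0 + ∑ i ∈ Finset.Icc 1 n, complKernel t α n i * F i ≤ G) :
    ∀ n ≤ N, x n ≤ 2 * G * mittagLeffler α (2 * μ * t n ^ α) := by
  have hG' : 0 ≤ G := (hx 0).trans hG0
  have htn : ∀ k, 0 ≤ t k := fun k => ht0 ▸ ht.monotone (Nat.zero_le k)
  have hz : ∀ k, 0 ≤ 2 * μ * t k ^ α := fun k =>
    mul_nonneg (by linarith) (Real.rpow_nonneg (htn k) _)
  have hE : Monotone fun k => 2 * G * mittagLeffler α (2 * μ * t k ^ α) := fun a b hab =>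
    mul_le_mul_of_nonneg_left
      (mittagLeffler_mono hα (hz a) (mul_le_mul_of_nonneg_left
        (Real.rpow_le_rpow (htn a) (ht.monotone hab) hα.le) (by linarith))) (by linarith)
  intro n
  induction n using Nat.strong_induction_on with
  | _ n ih =>
    intro hnN
    rcases Nat.eq_zero_or_pos n with rfl | hn
    · have h := one_le_mittagLeffler hα (hz 0)
      nlinarith
    by_cases hmax : ∃ k < n, x n ≤ x k
    · obtain ⟨k, hkn, hk⟩ := hmax
      exact hk.trans ((ih k hkn (by omega)).trans (hE hkn.le))
    · push Not at hmax
      have hDn : l1Deriv t α x n ≤ μ * x n + F n := hD n hn hnN _ fun k hk => by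
        rcases hk.eq_or_lt with rfl | hlt
        · exact le_rfl
        · exact (hmax k hlt).le
      have hDj : ∀ j ∈ Finset.Ico 1 n, complKernel t α n j * l1Deriv t α x j ≤
          complKernel t α n j * F j +
            μ * (2 * G) * (complKernel t α n j * mittagLeffler α (2 * μ * t j ^ α)) := by
        intro j hj
        obtain ⟨h1, h2⟩ := Finset.mem_Ico.mp hj
        have h := hD j h1 (by omega) (2 * G * mittagLeffler α (2 * μ * t j ^ α))
          fun k hk => (ih k (by omega) (by omega)).trans (hE hk)
        have h' := mul_le_mul_of_nonneg_left h (complKernel_nonneg ht hα hα1 h1 h2.le)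
        linarith
      have hPn := complKernel_nonneg ht hα hα1 hn le_rfl
      have hsum := Finset.sum_le_sum hDj
      rw [Finset.sum_add_distrib, ← Finset.mul_sum] at hsum
      have hid := sum_complKernel_mul_l1Deriv ht hα1 n x
      have hGn := hG n hn hnN
      rw [← Finset.sum_Ico_add_eq_sum_Icc hn] at hid hGn
      have hML := mul_le_mul_of_nonneg_left (mul_sum_complKernel_mul_mittagLeffler_le ht ht0 hconv
        hα hα1 (mul_nonneg zero_le_two hμ) hn) hG'
      have h1 := mul_le_mul_of_nonneg_left hDn hPn
      have h2 := mul_le_mul_of_nonneg_right (hstep n hn hnN) (hx n)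
      linarith

/-! ### The graded mesh -/

theorem gradedMesh_zero {T γ : ℝ} (hγ : 1 ≤ γ) (N : ℕ) : gradedMesh T γ N 0 = 0 := by
  rw [gradedMesh, Nat.cast_zero, zero_div, Real.zero_rpow (by linarith), zero_mul]

theorem strictMono_gradedMesh {T γ : ℝ} (hT : 0 < T) (hγ : 1 ≤ γ) {N : ℕ} (hN : 1 ≤ N) :
    StrictMono (gradedMesh T γ N) := by
  intro a b hab
  have hN' : (0 : ℝ) < N := by exact_mod_cast hN
  exact mul_lt_mul_of_pos_right (Real.rpow_lt_rpow (by positivity)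
    (div_lt_div_of_pos_right (by exact_mod_cast hab) hN') (by linarith)) hT

theorem gradedMesh_self {T γ : ℝ} {N : ℕ} (hN : 1 ≤ N) : gradedMesh T γ N N = T := by
  rw [gradedMesh, div_self (by positivity), Real.one_rpow, one_mul]

theorem step_gradedMesh_le_succ {T γ : ℝ} (hT : 0 < T) (hγ : 1 ≤ γ) {N : ℕ} (hN : 1 ≤ N) {n : ℕ}
    (hn : 1 ≤ n) : step (gradedMesh T γ N) n ≤ step (gradedMesh T γ N) (n + 1) := by
  obtain ⟨k, rfl⟩ := Nat.exists_eq_add_of_le' hn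
  have hN' : (0 : ℝ) < N := by exact_mod_cast hN
  have h := (convexOn_rpow hγ).2
    (Set.mem_Ici.mpr (show (0 : ℝ) ≤ (k : ℝ) / N by positivity))
    (Set.mem_Ici.mpr (show (0 : ℝ) ≤ ((k + 1 + 1 : ℕ) : ℝ) / N by positivity))
    (show (0 : ℝ) ≤ 1 / 2 by norm_num) (show (0 : ℝ) ≤ 1 / 2 by norm_num) (by norm_num)
  rw [show (1 / 2 : ℝ) • ((k : ℝ) / N) + (1 / 2 : ℝ) • (((k + 1 + 1 : ℕ) : ℝ) / N) =
    ((k + 1 : ℕ) : ℝ) / N by push_cast; simp only [smul_eq_mul]; ring] at h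
  simp only [smul_eq_mul] at h
  simp only [step, gradedMesh, Nat.add_sub_cancel, ← sub_mul]
  exact mul_le_mul_of_nonneg_right (by linarith) hT.le

theorem stepRatio_nonneg {t : ℕ → ℝ} (ht : StrictMono t) {n : ℕ} (hn : 2 ≤ n) :
    0 ≤ stepRatio t n :=
  (div_pos (step_pos ht (by omega)) (step_pos ht (by omega))).le

theorem stepRatio_le_maxStepRatio {t : ℕ → ℝ} {n N : ℕ} (hn : 2 ≤ n) (hnN : n ≤ N) :
    stepRatio t n ≤ maxStepRatio t N := by
  have hmem : n ∈ Finset.Icc 2 N := Finset.mem_Icc.mpr ⟨hn, hnN⟩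
  rw [maxStepRatio, dif_pos ⟨n, hmem⟩]
  exact Finset.le_sup' (stepRatio t) hmem

theorem maxStepRatio_nonneg {t : ℕ → ℝ} (ht : StrictMono t) (N : ℕ) : 0 ≤ maxStepRatio t N := by
  by_cases h : 2 ≤ N
  · exact (stepRatio_nonneg ht h).trans (stepRatio_le_maxStepRatio h le_rfl)
  · rw [maxStepRatio, dif_neg (by rw [Finset.nonempty_Icc]; exact h)]

/-- The restriction on the step size makes the diagonal term of the discrete problem absorbable. -/
theorem mul_complKernel_self_le {t : ℕ → ℝ} (ht : StrictMono t) {α μ : ℝ} (hα : 0 < α)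
    (hα1 : α < 1) (hμ : 0 ≤ μ) {N : ℕ} (hN : 1 ≤ N)
    (hstep : 0 < μ → maxStep t N hN < (1 / (2 * μ * Real.Gamma (2 - α))) ^ (1 / α))
    {n : ℕ} (hn : 1 ≤ n) (hnN : n ≤ N) : μ * complKernel t α n n ≤ 1 / 2 := by
  rcases hμ.eq_or_lt with rfl | hpos
  · norm_num
  have hG : 0 < Real.Gamma (2 - α) := Real.Gamma_pos_of_pos (by linarith)
  have hle : step t n ≤ maxStep t N hN :=
    Finset.le_sup' (step t) (Finset.mem_Icc.mpr ⟨hn, hnN⟩)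
  have h := Real.rpow_le_rpow (step_pos ht hn).le (hle.trans (hstep hpos).le) hα.le
  rw [← Real.rpow_mul (by positivity), one_div_mul_cancel hα.ne', Real.rpow_one,
    le_div_iff₀ (by positivity)] at h
  rw [complKernel_self, discKernel_self ht hα1 hn, one_div, inv_inv]
  linarith

/-! ### The L1 formula and norms -/

/-- Discrete maximum principle for the L1 formula: `D ψ^n ≥ 0` if `ψ^j ≤ 0` for
`j < n` and `ψ^n = 0`, because the weights `K^{n,j}` are positive and increase with `j`. -/
theorem l1Deriv_nonneg_of_nonpos {t : ℕ → ℝ} (ht : StrictMono t) {α : ℝ} (hα : 0 < α)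
    (hα1 : α < 1) {ψ : ℕ → ℝ} {n : ℕ} (hn : 1 ≤ n) (hψ : ∀ j < n, ψ j ≤ 0) (hψn : ψ n = 0) :
    0 ≤ l1Deriv t α ψ n := by
  have key : ∀ m, 1 ≤ m → m ≤ n → discKernel t (1 - α) n m * ψ m ≤
      ∑ j ∈ Finset.Icc 1 m, discKernel t (1 - α) n j * (ψ j - ψ (j - 1)) := by
    intro m hm
    induction m, hm using Nat.le_induction with
    | base =>
      intro h
      rw [Finset.Icc_self, Finset.sum_singleton]
      have h1 := (discKernel_pos ht hα1 le_rfl h).le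
      have h2 := hψ (1 - 1) (by omega)
      nlinarith
    | succ m hm ih =>
      intro h
      rw [Finset.sum_Icc_succ_top (by omega), Nat.add_sub_cancel]
      have h1 := ih (by omega)
      have h2 := discKernel_le_succ ht hα hα1 hm (show m < n by omega)
      have h3 := hψ m (by omega)
      nlinarith
  have h := key n hn le_rfl
  rw [hψn, mul_zero] at h
  exact h

theorem map_l1Deriv {V W : Type*} [AddCommGroup V] [Module ℝ V] [AddCommGroup W] [Module ℝ W]
    (L : V →ₗ[ℝ] W) (t : ℕ → ℝ) (α : ℝ) (φ : ℕ → V) (n : ℕ) :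
    L (l1Deriv t α φ n) = l1Deriv t α (fun k => L (φ k)) n := by
  simp only [l1Deriv, map_sum, map_smul, map_sub]

/-- Discrete analogue of `|φ| D|φ| ≤ (Dφ, φ)`: the maximum principle applied to the defect
`(φ^n, φ^k) - ‖φ^n‖ ‖φ^k‖` in the Cauchy-Schwarz inequality. -/
theorem norm_mul_l1Deriv_norm_le {V : Type*} [NormedAddCommGroup V] [InnerProductSpace ℝ V]
    {t : ℕ → ℝ} (ht : StrictMono t) {α : ℝ} (hα : 0 < α) (hα1 : α < 1) (φ : ℕ → V) {n : ℕ}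
    (hn : 1 ≤ n) :
    ‖φ n‖ * l1Deriv t α (fun k => ‖φ k‖) n ≤ inner ℝ (l1Deriv t α φ n) (φ n) := by
  have h := l1Deriv_nonneg_of_nonpos ht hα hα1
    (ψ := fun k => inner ℝ (φ n) (φ k) - ‖φ n‖ * ‖φ k‖) hn
    (fun j _ => sub_nonpos.mpr (real_inner_le_norm _ _))
    (by rw [real_inner_self_eq_norm_mul_norm, sub_self])
  have e : l1Deriv t α (fun k => inner ℝ (φ n) (φ k) - ‖φ n‖ * ‖φ k‖) n =
      inner ℝ (φ n) (l1Deriv t α φ n) - ‖φ n‖ * l1Deriv t α (fun k => ‖φ k‖) n := by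
    simp only [l1Deriv, inner_sum, Finset.mul_sum, ← Finset.sum_sub_distrib, inner_smul_right,
      inner_sub_right, smul_eq_mul]
    exact Finset.sum_congr rfl fun j _ => by ring
  rw [real_inner_comm]
  linarith

theorem l1Deriv_norm_le_of_inner_le {V : Type*} [NormedAddCommGroup V] [InnerProductSpace ℝ V]
    {t : ℕ → ℝ} (ht : StrictMono t) {α : ℝ} (hα : 0 < α) (hα1 : α < 1) (φ : ℕ → V) {n : ℕ}
    (hn : 1 ≤ n) {B : ℝ} (hB : 0 ≤ B) (h : inner ℝ (l1Deriv t α φ n) (φ n) ≤ ‖φ n‖ * B) :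
    l1Deriv t α (fun k => ‖φ k‖) n ≤ B := by
  rcases (norm_nonneg (φ n)).eq_or_lt with h0 | h0
  · -- The test function vanishes; the norms are then minimal at `n`.
    have h1 := l1Deriv_nonneg_of_nonpos ht hα hα1 (ψ := fun k => -‖φ k‖) hn
      (fun j _ => neg_nonpos.mpr (norm_nonneg _)) (by rw [← h0, neg_zero])
    have e : l1Deriv t α (fun k => -‖φ k‖) n = -l1Deriv t α (fun k => ‖φ k‖) n := by
      simp only [l1Deriv, ← Finset.sum_neg_distrib, smul_eq_mul]
      exact Finset.sum_congr rfl fun j _ => by ring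
    linarith
  · exact le_of_mul_le_mul_left ((norm_mul_l1Deriv_norm_le ht hα hα1 φ hn).trans h) h0

theorem Method.map_extrap {V W : Type*} [AddCommGroup V] [Module ℝ V] [AddCommGroup W]
    [Module ℝ W] (L : V →ₗ[ℝ] W) (m : Method) (t : ℕ → ℝ) (φ : ℕ → V) (n : ℕ) :
    L (m.extrap t φ n) = m.extrap t (fun k => L (φ k)) n := by
  cases m
  · rfl
  · rfl
  · simp only [Method.extrap]
    split_ifs
    · rfl
    · simp only [map_sub, map_smul]

/-- The lower order terms of each variant are bounded by `Λ₀` times a bound `M` for the values up to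
time level `n`. -/
theorem Method.norm_extrap_le {V : Type*} [NormedAddCommGroup V] [NormedSpace ℝ V] (m : Method)
    {t : ℕ → ℝ} (ht : StrictMono t) {φ : ℕ → V} {n N : ℕ} (hn : 1 ≤ n) (hnN : n ≤ N) {M : ℝ}
    (hM : ∀ k ≤ n, ‖φ k‖ ≤ M) (lam β₀ β₁ : ℝ) {β₂ : ℝ} (hβ₂ : 0 ≤ β₂) :
    β₁ ^ 2 / β₀ * M + 2 * |lam| * β₂ * ‖m.extrap t φ n‖ ≤
      m.Lambda0 lam β₀ β₁ β₂ (maxStepRatio t N) * M := by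
  have hc : 0 ≤ 2 * |lam| * β₂ := by positivity
  have hM0 : 0 ≤ M := (norm_nonneg _).trans (hM n le_rfl)
  have hρ := maxStepRatio_nonneg ht N
  have hmul : ∀ e : ℝ, ‖m.extrap t φ n‖ ≤ e * M →
      β₁ ^ 2 / β₀ * M + 2 * |lam| * β₂ * ‖m.extrap t φ n‖ ≤
        (β₁ ^ 2 / β₀ + 2 * |lam| * e * β₂) * M := fun e he => by
    have := mul_le_mul_of_nonneg_left he hc
    linarith
  cases m with
  | fullyImplicit => simpa [Method.Lambda0] using hmul 1 (by simpa [Method.extrap] using hM n le_rfl)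
  | imexOrderOne =>
    simpa [Method.Lambda0] using hmul 1 (by
      simpa [Method.extrap] using hM (n - 1) (Nat.sub_le n 1))
  | imexOrderTwo =>
    refine hmul _ ?_
    rw [Method.extrap]
    split_ifs with h1
    · have := hM 0 (Nat.zero_le n)
      nlinarith [mul_nonneg hρ hM0]
    · have hn2 : 2 ≤ n := by omega
      have hr := stepRatio_nonneg ht hn2
      have hrρ := stepRatio_le_maxStepRatio (t := t) hn2 hnN
      calc ‖(1 + stepRatio t n) • φ (n - 1) - stepRatio t n • φ (n - 2)‖
          ≤ (1 + stepRatio t n) * ‖φ (n - 1)‖ + stepRatio t n * ‖φ (n - 2)‖ := by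
            refine (norm_sub_le _ _).trans_eq ?_
            rw [norm_smul, norm_smul, Real.norm_of_nonneg hr,
              Real.norm_of_nonneg (by linarith : 0 ≤ 1 + stepRatio t n)]
        _ ≤ (1 + maxStepRatio t N) * M + maxStepRatio t N * M := by
            gcongr
            · exact hM _ (Nat.sub_le n 1)
            · exact hM _ (Nat.sub_le n 2)
        _ = (1 + 2 * maxStepRatio t N) * M := by ring

theorem Method.Lambda0_nonneg (m : Method) (lam : ℝ) {β₀ β₁ β₂ ρ : ℝ} (hβ₀ : 0 < β₀)
    (hβ₂ : 0 ≤ β₂) (hρ : 0 ≤ ρ) : 0 ≤ m.Lambda0 lam β₀ β₁ β₂ ρ := by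
  cases m <;> simp only [Method.Lambda0] <;> positivity

/-! ### The energy estimate -/

/-- The map `u ↦ u` from `H¹(Ω)` to `L²(Ω)` as a linear map. -/
def fnLinear {d : ℕ} (Ω : TopologicalSpace.Opens (Pt d)) : H1 Ω →ₗ[ℝ] L2 Ω where
  toFun := fn
  map_add' _ _ := rfl
  map_smul' _ _ := rfl

theorem Problem.aestronglyMeasurable_intOp {d : ℕ} (P : Problem d) (φ : L2 P.Ω) :
    AEStronglyMeasurable (P.intOp φ) (volume.restrict (P.Ω : Set (Pt d))) :=
  ((Lp.aestronglyMeasurable φ).comp_snd.mul P.g_meas).integral_prod_right'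

theorem Problem.abs_integral_intOp_mul_le {d : ℕ} (P : Problem d) {β₂ : ℝ}
    (hβ₂ : P.IsIntOpBound β₂) (φ ψ : L2 P.Ω) :
    |∫ x in (P.Ω : Set (Pt d)), P.intOp φ x * ψ x| ≤ β₂ * ‖φ‖ * ‖ψ‖ := by
  have hle := hβ₂.2 φ
  have hmem : MemLp (P.intOp φ) 2 (volume.restrict (P.Ω : Set (Pt d))) :=
    ⟨P.aestronglyMeasurable_intOp φ, hle.trans_lt ENNReal.ofReal_lt_top⟩
  have hnorm : ‖hmem.toLp‖ ≤ β₂ * ‖φ‖ := by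
    rw [Lp.norm_toLp]
    exact ENNReal.toReal_le_of_le_ofReal (mul_nonneg hβ₂.1 (norm_nonneg _)) hle
  have e : ∫ x in (P.Ω : Set (Pt d)), P.intOp φ x * ψ x = inner ℝ ψ hmem.toLp := by
    rw [L2.inner_def]
    refine integral_congr_ae ?_
    filter_upwards [hmem.coeFn_toLp] with x hx
    rw [hx]
    rfl
  rw [e, mul_comm]
  exact (abs_real_inner_le_norm _ _).trans (mul_le_mul_of_nonneg_left hnorm (norm_nonneg _))

/-- Testing the scheme with its solution bounds the L1 formula of the norms. -/
theorem IsDiscreteSolution.l1Deriv_norm_le {d : ℕ} {P : Problem d} {β₀ β₁ β₂ : ℝ}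
    (hβ₀ : P.IsCoercivityConst β₀) (hβ₁ : P.IsLowerOrderBound β₁) (hβ₂ : P.IsIntOpBound β₂)
    {S : Submodule ℝ (H1 P.Ω)} (hS : S ≤ H10 P.Ω) {m : Method} {t : ℕ → ℝ} (ht : StrictMono t)
    {N : ℕ} {f : ℝ → L2 P.Ω} {u : ℕ → H1 P.Ω} (hu : IsDiscreteSolution P S m t N f u) {n : ℕ}
    (hn : 1 ≤ n) (hnN : n ≤ N) (htn : t n ∈ Set.Ioc 0 P.T) {M : ℝ}
    (hM : ∀ k ≤ n, ‖fn (u k)‖ ≤ M) :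
    l1Deriv t P.α (fun k => ‖fn (u k)‖) n ≤
      m.Lambda0 P.lam β₀ β₁ β₂ (maxStepRatio t N) * M + ‖f (t n)‖ := by
  have hM0 : 0 ≤ M := (norm_nonneg _).trans (hM n le_rfl)
  have hΛ := m.Lambda0_nonneg P.lam (β₁ := β₁) hβ₀.1 hβ₂.1 (maxStepRatio_nonneg ht N)
  refine l1Deriv_norm_le_of_inner_le ht P.α_pos P.α_lt_one (fun k => fn (u k)) hn
    (by positivity) ?_
  have hmem := hu.1 n hnN
  have heq := hu.2 n hn hnN (u n) hmem
  have hD : fn (l1Deriv t P.α u n) = l1Deriv t P.α (fun k => fn (u k)) n :=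
    map_l1Deriv (fnLinear P.Ω) t P.α u n
  have hE : fn (m.extrap t u n) = m.extrap t (fun k => fn (u k)) n :=
    m.map_extrap (fnLinear P.Ω) t u n
  rw [hD, hE, Problem.a] at heq
  set x := ‖fn (u n)‖ with hx
  have hx0 : 0 ≤ x := norm_nonneg _
  have ha0 := hβ₀.2 (t n) htn (u n) (hS hmem)
  have ha1 := (abs_le.mp (hβ₁.2 (t n) htn (u n) (hS hmem) (u n) (hS hmem))).1
  have hI := P.abs_integral_intOp_mul_le hβ₂ (m.extrap t (fun k => fn (u k)) n) (fn (u n))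
  have hf := real_inner_le_norm (f (t n)) (fn (u n))
  have hlamI := (le_abs_self _).trans_eq (abs_mul P.lam
    (∫ y in (P.Ω : Set (Pt d)), P.intOp (m.extrap t (fun k => fn (u k)) n) y * fn (u n) y))
  have hlamI' := mul_le_mul_of_nonneg_left hI (abs_nonneg P.lam)
  have hext := m.norm_extrap_le ht hn hnN hM P.lam β₀ β₁ hβ₂.1
  -- Young's inequality absorbs the gradient part of the lower order terms.
  have hyoung : β₁ * ‖u n‖ * x ≤ β₀ * ‖u n‖ ^ 2 + β₁ ^ 2 / β₀ * x * x := by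
    have hsq : 0 ≤ (2 * β₀ * ‖u n‖ - β₁ * x) ^ 2 / (4 * β₀) :=
      div_nonneg (sq_nonneg _) (by linarith [hβ₀.1])
    have e : (2 * β₀ * ‖u n‖ - β₁ * x) ^ 2 / (4 * β₀) =
        β₀ * ‖u n‖ ^ 2 - β₁ * ‖u n‖ * x + β₁ ^ 2 / β₀ * x * x / 4 := by
      have := hβ₀.1.ne'
      field_simp
      ring
    have hp : 0 ≤ β₁ ^ 2 / β₀ * x * x :=
      mul_nonneg (mul_nonneg (div_nonneg (sq_nonneg _) hβ₀.1.le) hx0) hx0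
    linarith
  have hxM : β₁ ^ 2 / β₀ * x * x ≤ β₁ ^ 2 / β₀ * M * x :=
    mul_le_mul_of_nonneg_right (mul_le_mul_of_nonneg_left (hM n le_rfl)
      (div_nonneg (sq_nonneg _) hβ₀.1.le)) hx0
  have hext' := mul_le_mul_of_nonneg_right hext hx0
  have hpos : 0 ≤ |P.lam| * (β₂ * ‖m.extrap t (fun k => fn (u k)) n‖ * x) :=
    mul_nonneg (abs_nonneg _) (mul_nonneg (mul_nonneg hβ₂.1 (norm_nonneg _)) hx0)
  linarith

end IMEXL1

theorem mainTheorem6 {d : ℕ} (P : IMEXL1.Problem d)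
    (β₀ β₁ β₂ : ℝ) (hβ₀ : P.IsCoercivityConst β₀) (hβ₁ : P.IsLowerOrderBound β₁)
    (hβ₂ : P.IsIntOpBound β₂)
    (γ : ℝ) (hγ : 1 ≤ γ) (N : ℕ) (hN : 1 ≤ N)
    (t : ℕ → ℝ) (ht : t = IMEXL1.gradedMesh P.T γ N)
    (S : Submodule ℝ (IMEXL1.H1 P.Ω)) (hS : S ≤ IMEXL1.H10 P.Ω) (hSfin : FiniteDimensional ℝ S)
    (m : IMEXL1.Method) (f : ℝ → IMEXL1.L2 P.Ω) (u : ℕ → IMEXL1.H1 P.Ω)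
    (hu : IMEXL1.IsDiscreteSolution P S m t N f u)
    (Λ₀ C₀ : ℝ) (hΛ₀ : Λ₀ = m.Lambda0 P.lam β₀ β₁ β₂ (IMEXL1.maxStepRatio t N)) (hC₀ : C₀ = 2)
    (hstep : 0 < Λ₀ →
      IMEXL1.maxStep t N hN < (1 / (2 * Λ₀ * Real.Gamma (2 - P.α))) ^ (1 / P.α)) :
    ∀ (n : ℕ) (hn : 1 ≤ n), n ≤ N →
      ‖IMEXL1.fn (u n)‖ ≤ 2 * C₀ * IMEXL1.mittagLeffler P.α (2 * Λ₀ * t n ^ P.α) *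
        (‖IMEXL1.fn (u 0)‖ +
          (Finset.Icc 1 n).sup' (Finset.nonempty_Icc.mpr hn) fun j =>
            ∑ i ∈ Finset.Icc 1 j, IMEXL1.complKernel t P.α j i * ‖f (t i)‖) := by
  intro n hn hnN
  have hmono : StrictMono t := ht ▸ IMEXL1.strictMono_gradedMesh P.T_pos hγ hN
  have ht0 : t 0 = 0 := ht ▸ IMEXL1.gradedMesh_zero hγ N
  have htN : t N = P.T := ht ▸ IMEXL1.gradedMesh_self hN
  have hconv : ∀ k, 1 ≤ k → IMEXL1.step t k ≤ IMEXL1.step t (k + 1) := fun k hk =>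
    ht ▸ IMEXL1.step_gradedMesh_le_succ P.T_pos hγ hN hk
  have hmem : ∀ k, 1 ≤ k → k ≤ N → t k ∈ Set.Ioc 0 P.T := fun k hk hkN =>
    ⟨ht0 ▸ hmono (show 0 < k by omega), htN ▸ hmono.monotone hkN⟩
  have hΛ : 0 ≤ Λ₀ := hΛ₀ ▸ m.Lambda0_nonneg P.lam hβ₀.1 hβ₂.1 (IMEXL1.maxStepRatio_nonneg hmono N)
  set Fmax := (Finset.Icc 1 n).sup' (Finset.nonempty_Icc.mpr hn) fun j =>
    ∑ i ∈ Finset.Icc 1 j, IMEXL1.complKernel t P.α j i * ‖f (t i)‖ with hFmax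
  have hF : ∀ j, 1 ≤ j → j ≤ n →
      ∑ i ∈ Finset.Icc 1 j, IMEXL1.complKernel t P.α j i * ‖f (t i)‖ ≤ Fmax := fun j hj hjn =>
    Finset.le_sup' (fun j => ∑ i ∈ Finset.Icc 1 j, IMEXL1.complKernel t P.α j i * ‖f (t i)‖)
      (Finset.mem_Icc.mpr ⟨hj, hjn⟩)
  have hF0 : 0 ≤ Fmax := le_trans (Finset.sum_nonneg fun i hi => mul_nonneg
    (IMEXL1.complKernel_nonneg hmono P.α_pos P.α_lt_one (Finset.mem_Icc.mp hi).1
      (Finset.mem_Icc.mp hi).2) (norm_nonneg _)) (hF n hn le_rfl)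
  have h := IMEXL1.le_two_mul_mittagLeffler_of_l1Deriv_le hmono ht0 hconv P.α_pos P.α_lt_one hΛ
    (N := n) (x := fun k => ‖IMEXL1.fn (u k)‖) (F := fun k => ‖f (t k)‖)
    (G := ‖IMEXL1.fn (u 0)‖ + Fmax) (fun k => norm_nonneg _)
    (fun k hk hkn => IMEXL1.mul_complKernel_self_le hmono P.α_pos P.α_lt_one hΛ hN hstep hk
      (hkn.trans hnN))
    (fun k hk hkn M hM => hΛ₀ ▸ hu.l1Deriv_norm_le hβ₀ hβ₁ hβ₂ hS hmono hk (hkn.trans hnN)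
      (hmem k hk (hkn.trans hnN)) hM)
    (le_add_of_nonneg_right hF0) (fun k hk hkn => add_le_add_right (hF k hk hkn) _) n le_rfl
  -- The estimate holds with `2` in place of `2 * C₀ = 4`.
  have hE := IMEXL1.one_le_mittagLeffler P.α_pos (z := 2 * Λ₀ * t n ^ P.α)
    (mul_nonneg (by linarith) (Real.rpow_nonneg (hmem n hn hnN).1.le _))
  have hG : 0 ≤ ‖IMEXL1.fn (u 0)‖ + Fmax := add_nonneg (norm_nonneg _) hF0
  refine h.trans ?_
  rw [hC₀]
  nlinarith [mul_nonneg hG (zero_le_one.trans hE)]
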